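/- Let $\mathbb R^+=[0,\infty)$. For $E\subseteq\mathbb R^+$ and $h>0$ let $\lambda(E,0,h)$ be the length of the largest open subinterval of $(0,h)$ (possibly empty) that contains no point of $E$. The set $E$ is *strongly porous* (on the right at $0$) if $\limsup_{h\to0^+}\lambda(E,0,h)/h=1$. It is *completely strongly porous* if for every sequence $\tau_n\downarrow0$ of points of $E\setminus\{0\}$ there are a sequence of positive numbers $h_n\downarrow0$ with $\lambda(E,0,h_n)/h_n\to1$ and constants $c_1,c_2>0$ such that $c_1\tau_n\le h_n\le c_2\tau_n$ for all $n$. Let $\mathbf{SP}$ and $\mathbf{CSP}$ be the collections of all strongly porous and of all completely strongly porous subsets of $\mathbb R^+$, respectively. An *ideal on a set* $V$ is a collection of subsets of $V$ that is closed under passing to subsets and under unions of two members and does not contain $V$. For a collection of sets $\Gamma$ let $I(\Gamma)$ be the collection of all unions $A_1\cup\dots\cup A_n$ with $n\ge1$ and $A_1,\dots,A_n\in\Gamma$. Let $\hat I(\Gamma)$ be the intersection of all $\Gamma$-maximal ideals, that is, of all ideals on $V=\bigcup_{A\in\Gamma}A$ that are contained in $\Gamma$ and are maximal with respect to inclusion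 among the ideals on $V$ contained in $\Gamma$. Then $$I(\mathbf{CSP})\subsetneq\hat I(\mathbf{SP}).$$ Moreover, let $\alpha\in(0,1)$. There are positive numbers $y_{k,j}$ ($j\ge1$, $0\le k\le j$) such that $$y_{k,j}=\alpha^{k}\,y_{k-1,j}\quad(1\le k\le j),\qquad y_{0,j+1}<y_{j,j}\quad(j\ge1),\qquad \lim_{j\to\infty}\frac{y_{j,j}}{y_{0,j+1}}=\infty,$$ and for every such family the set $$E=\bigcup_{j\ge1}\{y_{0,j},y_{1,j},\dots,y_{j,j}\}$$ belongs to $\hat I(\mathbf{SP})$ but not to $I(\mathbf{CSP})$. -/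

import Mathlib

open Set Filter Topology

namespace RightPorosity

/-! ### Porosity on the right at `0` of subsets of `[0, ∞)` -/

/-- The length of the largest open subinterval `(a, b)` of `(0, h)` (possibly empty, `a = b`)
that contains no point of `E`. For `h ≥ 0` the set of lengths is nonempty and bounded by `h`. -/
noncomputable def gap (E : Set ℝ) (h : ℝ) : ℝ :=
  sSup {l : ℝ | ∃ a b : ℝ, 0 ≤ a ∧ a ≤ b ∧ b ≤ h ∧ Disjoint (Ioo a b) E ∧ l = b - a}

/-- The right upper porosity of `E` at `0`. The quotient lies in `[0, 1]` for `h > 0`. -/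
noncomputable def porosity (E : Set ℝ) : ℝ :=
  limsup (fun h : ℝ => gap E h / h) (𝓝[>] (0 : ℝ))

/-- The collection of subsets of `[0, ∞)` that are strongly porous on the right at `0`. -/
def SP : Set (Set ℝ) := {E | E ⊆ Ici 0 ∧ porosity E = 1}

/-- `h n ↓ 0`: a decreasing sequence of positive numbers that tends to `0`. -/
def DecreasesToZero (h : ℕ → ℝ) : Prop :=
  (∀ n, 0 < h n) ∧ Antitone h ∧ Tendsto h atTop (𝓝 0)

/-- The sequences `h n ↓ 0` of points of `E \ {0}`. -/
def pointSeqs (E : Set ℝ) : Set (ℕ → ℝ) :=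
  {h | DecreasesToZero h ∧ ∀ n, h n ∈ E \ {0}}

/-- The sequences `h n ↓ 0` along which the relative length of the largest gap tends to `1`. -/
def gapSeqs (E : Set ℝ) : Set (ℕ → ℝ) :=
  {h | DecreasesToZero h ∧ Tendsto (fun n => gap E (h n) / h n) atTop (𝓝 1)}

/-- The relation `a ≍ g` between sequences of positive numbers. -/
def Comparable (a g : ℕ → ℝ) : Prop :=
  ∃ c₁ c₂ : ℝ, 0 < c₁ ∧ 0 < c₂ ∧ ∀ n, c₁ * a n ≤ g n ∧ g n ≤ c₂ * a n

/-- The collection of subsets of `[0, ∞)` that are completely strongly porous on the right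
at `0`. -/
def CSP : Set (Set ℝ) :=
  {E | E ⊆ Ici 0 ∧ ∀ τ ∈ pointSeqs E, ∃ h ∈ gapSeqs E, Comparable τ h}

/-! ### Ideals of sets -/

/-- A collection of sets that is closed under passing to subsets. -/
def IsDownSet {X : Type*} (A : Set (Set X)) : Prop :=
  ∀ B C : Set X, B ∈ A → C ⊆ B → C ∈ A

/-- `I` is an ideal on the set `V`. -/
def IsIdealOn {X : Type*} (V : Set X) (I : Set (Set X)) : Prop :=
  (∀ B ∈ I, B ⊆ V) ∧ IsDownSet I ∧ (∀ B ∈ I, ∀ C ∈ I, B ∪ C ∈ I) ∧ V ∉ I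

/-- The ideal generated by `Γ`: the unions of finitely many (at least one) members of `Γ`. -/
def generatedIdeal {X : Type*} (Γ : Set (Set X)) : Set (Set X) :=
  {B | ∃ n : ℕ, 1 ≤ n ∧ ∃ A : Fin n → Set X, (∀ j, A j ∈ Γ) ∧ B = ⋃ j, A j}

/-- `I` is a `Γ`-maximal ideal: maximal among the ideals on `⋃ Γ` that are contained in `Γ`. -/
def IsMaximalIdealIn {X : Type*} (Γ I : Set (Set X)) : Prop :=
  IsIdealOn (⋃₀ Γ) I ∧ I ⊆ Γ ∧
    ∀ J : Set (Set X), IsIdealOn (⋃₀ Γ) J → I ⊆ J → J ⊆ Γ → I = J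

/-- The intersection of all `Γ`-maximal ideals. -/
def hatIdeal {X : Type*} (Γ : Set (Set X)) : Set (Set X) :=
  ⋂₀ {I | IsMaximalIdealIn Γ I}

/-! ### Sets built from geometric blocks -/

/-- The `j`-th block (`j ≥ 1`) consists of positive numbers `y 0 j, …, y j j` with
`y k j = α ^ k * y (k - 1) j` for `1 ≤ k ≤ j`; consecutive blocks are disjoint and separated by
quotients that tend to infinity. -/
structure IsBlockFamily (α : ℝ) (y : ℕ → ℕ → ℝ) : Prop where
  pos : ∀ j, 1 ≤ j → ∀ k, k ≤ j → 0 < y k j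
  step : ∀ j, 1 ≤ j → ∀ k, 1 ≤ k → k ≤ j → y k j = α ^ k * y (k - 1) j
  lt : ∀ j, 1 ≤ j → y 0 (j + 1) < y j j
  sep : Tendsto (fun j : ℕ => y j j / y 0 (j + 1)) atTop atTop

/-- The set of all the numbers `y k j` with `j ≥ 1` and `0 ≤ k ≤ j`. -/
def blockSet (y : ℕ → ℕ → ℝ) : Set ℝ :=
  {x | ∃ j k : ℕ, 1 ≤ j ∧ k ≤ j ∧ x = y k j}

end RightPorosity

/-!
Strong porosity of `E ⊆ [0, ∞)` means that arbitrarily close to `0` there are intervals `(a, b)`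
free of points of `E` with `a / b` as small as desired (`mem_SP_iff`). Call `B` *absorbable* when
`A ∪ B ∈ SP` for every `A ∈ SP`. An absorbable set can be added to any `SP`-maximal ideal without
leaving `SP`, so it lies in the ideal already (`absorbable_subset_hatIdeal`), and a finite union of
absorbable sets is absorbable. Both memberships in `hatIdeal SP` are proved through absorbability.

* A completely strongly porous `B` is absorbable (`absorbable_of_mem_CSP`): inside a very long gap
  `(a, b)` of `A`, either a middle part misses `B` and is a gap of `A ∪ B`, or there is a point
  `τ` of `B` with `a ≪ τ ≪ b`. Complete strong porosity gives long gaps of `B` with right ends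
  comparable to such points `τ`, and these gaps essentially lie in `(a, b)`.
* A block set is absorbable (`absorbable_blockSet`): two of its points close to `0` with a ratio
  bounded away from `0` lie in the same block and the larger one has bounded index, so a long
  chain of points with such ratios does not exist. A gap of `A` long enough to be cut into more
  pieces than the chain can have contains a piece that misses the block set.
* A block set is not a finite union of `A i ∈ CSP` (`blockSet_notMem_generatedIdeal`): fix a
  nonprincipal ultrafilter on the block indices `j`. For each `m`, some `A i` contains `y m j` for
  almost all `j`. But once this happens for `i`, the gaps of `A i` comparable to `y m j` swallow
  `y m' j` for all large `m'` (and almost all `j`), because `y m' j / y m j` does not depend on `j`.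
  So each `i` serves only finitely many `m`, which is absurd.
-/

namespace RightPorosity

/-! ### Gaps and strong porosity -/

lemma bddAbove_gap_lengths (E : Set ℝ) (h : ℝ) :
    BddAbove {l : ℝ | ∃ a b : ℝ, 0 ≤ a ∧ a ≤ b ∧ b ≤ h ∧ Disjoint (Ioo a b) E ∧ l = b - a} := by
  refine ⟨h, ?_⟩
  rintro l ⟨a, b, ha, -, hb, -, rfl⟩
  linarith

lemma sub_le_gap {E : Set ℝ} {a b h : ℝ} (ha : 0 ≤ a) (hab : a ≤ b) (hb : b ≤ h)
    (hd : Disjoint (Ioo a b) E) : b - a ≤ gap E h :=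
  le_csSup (bddAbove_gap_lengths E h) ⟨a, b, ha, hab, hb, hd, rfl⟩

lemma gap_le {E : Set ℝ} {h : ℝ} (hh : 0 ≤ h) : gap E h ≤ h := by
  refine csSup_le ⟨0, 0, 0, le_rfl, le_rfl, hh, by simp, by simp⟩ ?_
  rintro l ⟨a, b, ha, -, hb, -, rfl⟩
  linarith

lemma gap_nonneg {E : Set ℝ} {h : ℝ} (hh : 0 ≤ h) : 0 ≤ gap E h := by
  simpa using sub_le_gap (E := E) le_rfl le_rfl hh (by simp)

/-- If the largest gap in `(0, h)` has relative length close to `1`, then there is a gap `(a, b)`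
with `b` comparable to `h` and `a / b` small. -/
lemma exists_gap_of_lt_gap_div {E : Set ℝ} {ε h : ℝ} (hε : 0 < ε) (hε1 : ε ≤ 1) (hh : 0 < h)
    (hg : 1 - ε / 2 < gap E h / h) :
    ∃ a b : ℝ, 0 ≤ a ∧ h / 2 < b ∧ b ≤ h ∧ a ≤ ε * b ∧ Disjoint (Ioo a b) E := by
  rw [lt_div_iff₀ hh] at hg
  obtain ⟨l, ⟨a, b, ha, -, hb, hd, rfl⟩, hl⟩ :=
    exists_lt_of_lt_csSup (s := {l : ℝ | ∃ a b : ℝ, 0 ≤ a ∧ a ≤ b ∧ b ≤ h ∧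
      Disjoint (Ioo a b) E ∧ l = b - a}) ⟨0, 0, 0, le_rfl, le_rfl, hh.le, by simp, by simp⟩ hg
  have hεh : ε * h ≤ h := by nlinarith
  have hb2 : h / 2 < b := by nlinarith
  refine ⟨a, b, ha, hb2, hb, ?_, hd⟩
  nlinarith [mul_lt_mul_of_pos_left hb2 hε]

/-- Arbitrarily close to `0` there are gaps `(a, b)` of `E` with `a / b` arbitrarily small. -/
def HasLongGaps (E : Set ℝ) : Prop :=
  ∀ ε : ℝ, 0 < ε → ∀ δ : ℝ, 0 < δ →
    ∃ a b : ℝ, 0 ≤ a ∧ 0 < b ∧ b < δ ∧ a ≤ ε * b ∧ Disjoint (Ioo a b) E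

lemma HasLongGaps.mono {E F : Set ℝ} (hE : HasLongGaps E) (hF : F ⊆ E) : HasLongGaps F := by
  intro ε hε δ hδ
  obtain ⟨a, b, ha, hb, hbδ, hab, hd⟩ := hE ε hε δ hδ
  exact ⟨a, b, ha, hb, hbδ, hab, hd.mono_right hF⟩

lemma eventually_gap_div_le (E : Set ℝ) : ∀ᶠ h in 𝓝[>] (0 : ℝ), gap E h / h ≤ 1 := by
  filter_upwards [self_mem_nhdsWithin] with h hh
  exact div_le_one_of_le₀ (gap_le (le_of_lt hh)) (le_of_lt hh)

lemma eventually_gap_div_nonneg (E : Set ℝ) : ∀ᶠ h in 𝓝[>] (0 : ℝ), 0 ≤ gap E h / h := by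
  filter_upwards [self_mem_nhdsWithin] with h hh
  exact div_nonneg (gap_nonneg (le_of_lt hh)) (le_of_lt hh)

lemma porosity_eq_one_iff (E : Set ℝ) : porosity E = 1 ↔ HasLongGaps E := by
  have hbdd : IsBoundedUnder (· ≤ ·) (𝓝[>] (0 : ℝ)) (fun h => gap E h / h) :=
    ⟨1, eventually_gap_div_le E⟩
  have hcobdd : IsCoboundedUnder (· ≤ ·) (𝓝[>] (0 : ℝ)) (fun h => gap E h / h) :=
    IsBoundedUnder.isCoboundedUnder_le ⟨0, eventually_gap_div_nonneg E⟩
  constructor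
  · intro hp ε hε δ hδ
    have hη : 0 < min ε 1 := lt_min hε one_pos
    have hlt : 1 - min ε 1 / 2 < limsup (fun h => gap E h / h) (𝓝[>] (0 : ℝ)) := by
      change _ < porosity E
      rw [hp]
      linarith
    have hfreq := frequently_lt_of_lt_limsup hcobdd hlt
    obtain ⟨h, hg, hh⟩ := (hfreq.and_eventually (Ioo_mem_nhdsGT hδ)).exists
    obtain ⟨a, b, ha, hb, hbh, hab, hd⟩ :=
      exists_gap_of_lt_gap_div hη (min_le_right _ _) hh.1 hg
    have hb0 : 0 < b := by linarith [hh.1]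
    exact ⟨a, b, ha, hb0, hbh.trans_lt hh.2,
      hab.trans (mul_le_mul_of_nonneg_right (min_le_left _ _) hb0.le), hd⟩
  · intro hE
    refine le_antisymm (limsup_le_of_le hcobdd (eventually_gap_div_le E)) ?_
    refine le_of_forall_pos_sub_le fun ε hε => ?_
    refine le_limsup_of_frequently_le ?_ hbdd
    rw [(nhdsGT_basis (0 : ℝ)).frequently_iff]
    intro δ hδ
    obtain ⟨a, b, ha, hb, hbδ, hab, hd⟩ := hE (min ε 1) (lt_min hε one_pos) δ hδ
    refine ⟨b, ⟨hb, hbδ⟩, ?_⟩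
    have hab' : a ≤ b := hab.trans (mul_le_of_le_one_left hb.le (min_le_right _ _))
    have hgap := sub_le_gap ha hab' le_rfl hd
    rw [le_div_iff₀ hb]
    have := mul_le_mul_of_nonneg_right (min_le_left ε 1) hb.le
    linarith

lemma mem_SP_iff {E : Set ℝ} : E ∈ SP ↔ E ⊆ Ici 0 ∧ HasLongGaps E :=
  and_congr_right fun _ => porosity_eq_one_iff E

lemma SP_mono {E F : Set ℝ} (hE : E ∈ SP) (hF : F ⊆ E) : F ∈ SP := by
  rw [mem_SP_iff] at hE ⊢
  exact ⟨hF.trans hE.1, hE.2.mono hF⟩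

lemma singleton_mem_SP {x : ℝ} (hx : 0 ≤ x) : {x} ∈ SP := by
  rw [mem_SP_iff]
  refine ⟨by simpa using hx, fun ε hε δ hδ => ?_⟩
  rcases hx.eq_or_lt with rfl | hx
  · exact ⟨0, δ / 2, le_rfl, by linarith, by linarith, by positivity, by simp⟩
  · have hm : 0 < min δ x := lt_min hδ hx
    refine ⟨0, min δ x / 2, le_rfl, by linarith, ?_, by positivity, ?_⟩
    · linarith [min_le_left δ x]
    · simp only [disjoint_singleton_right, mem_Ioo, not_and, not_lt]
      intro
      linarith [min_le_right δ x]

lemma empty_mem_SP : ∅ ∈ SP := SP_mono (singleton_mem_SP le_rfl) (empty_subset _)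

lemma sUnion_SP : ⋃₀ SP = Ici 0 :=
  subset_antisymm (sUnion_subset fun _ hE => hE.1)
    fun x hx => ⟨{x}, singleton_mem_SP hx, rfl⟩

lemma Ici_notMem_SP : Ici 0 ∉ SP := by
  rw [mem_SP_iff]
  rintro ⟨-, hE⟩
  obtain ⟨a, b, ha, hb, -, hab, hd⟩ := hE (1 / 2) (by norm_num) 1 one_pos
  have hmid : (a + b) / 2 ∈ Ioo a b := ⟨by linarith, by linarith⟩
  exact Set.disjoint_left.1 hd hmid (mem_Ici.2 (by linarith))

/-! ### Absorbable sets -/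

/-- The sets whose union with any strongly porous set is strongly porous. -/
def Absorbable : Set (Set ℝ) := {B | ∀ A ∈ SP, A ∪ B ∈ SP}

/-- The sets covered by a member of an ideal and an absorbable set form an ideal, so a maximal
ideal contains the absorbable sets. -/
lemma absorbable_subset_hatIdeal : Absorbable ⊆ hatIdeal SP := by
  rintro B hB I ⟨hI, hISP, hmax⟩
  -- `∅` is added because the empty collection is formally an ideal.
  let J : Set (Set ℝ) := {C | ∃ D ∈ insert ∅ I, C ⊆ D ∪ B}
  have hJSP : J ⊆ SP := by
    rintro C ⟨D, rfl | hD, hC⟩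
    · exact SP_mono (hB ∅ empty_mem_SP) hC
    · exact SP_mono (hB D (hISP hD)) hC
  have hJ : IsIdealOn (⋃₀ SP) J := by
    refine ⟨fun C hC => subset_sUnion_of_mem (hJSP hC), ?_, ?_, ?_⟩
    · rintro C C' ⟨D, hD, hC⟩ hC'
      exact ⟨D, hD, hC'.trans hC⟩
    · rintro C ⟨D, hD, hC⟩ C' ⟨D', hD', hC'⟩
      refine ⟨D ∪ D', ?_, ?_⟩
      · rcases hD with rfl | hD
        · rwa [empty_union]
        · rcases hD' with rfl | hD'
          · rw [union_empty]
            exact Or.inr hD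
          · exact Or.inr (hI.2.2.1 D hD D' hD')
      · rw [union_union_distrib_right]
        exact union_subset_union hC hC'
    · intro hV
      rw [sUnion_SP] at hV
      exact Ici_notMem_SP (hJSP hV)
  have hIJ : I ⊆ J := fun C hC => ⟨C, Or.inr hC, subset_union_left⟩
  rw [hmax J hJ hIJ hJSP]
  exact ⟨∅, Or.inl rfl, subset_union_right⟩

lemma iUnion_mem_absorbable : ∀ {n : ℕ} {A : Fin n → Set ℝ}, (∀ j, A j ∈ Absorbable) →
    ⋃ j, A j ∈ Absorbable
  | 0, A, _ => fun S hS => by simpa using hS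
  | n + 1, A, hA => fun S hS => by
    have h := iUnion_mem_absorbable (fun j : Fin n => hA j.succ) _ (hA 0 S hS)
    have hU : ⋃ j, A j = A 0 ∪ ⋃ j : Fin n, A j.succ := by
      ext x
      simp [Fin.exists_fin_succ]
    rwa [hU, ← union_assoc]

/-! ### Completely strongly porous sets are absorbable -/

/-- A set `B` such that, within every sufficiently long gap `(a, b)` of `A` close to `0`, there is
a point `τ` of `B` with `a ≪ τ ≪ b`, yields a sequence of such points decreasing to `0`. -/
lemma exists_pointSeq_between {A B : Set ℝ} {ε δ : ℝ} (hA : HasLongGaps A) (hε : 0 < ε)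
    (hδ : 0 < δ)
    (H : ∀ η : ℝ, 0 < η → η ≤ ε → ∀ a b : ℝ, 0 ≤ a → 0 < b → b < δ → a ≤ η ^ 3 * b →
      Disjoint (Ioo a b) A → ∃ τ ∈ B, η ^ 2 * b < τ ∧ τ < η * b) :
    ∃ τ ∈ pointSeqs B, ∃ η a b : ℕ → ℝ, Tendsto η atTop (𝓝 0) ∧ ∀ n, 0 < η n ∧
      0 ≤ a n ∧ a n ≤ η n * τ n ∧ τ n ≤ η n * b n ∧ b n < δ ∧ Disjoint (Ioo (a n) (b n)) A := by
  let η : ℕ → ℝ := fun n => ε * (1 / ((n : ℝ) + 1))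
  have hη : ∀ n, 0 < η n := fun n => by positivity
  have hηε : ∀ n, η n ≤ ε := fun n => by
    refine mul_le_of_le_one_right hε.le ?_
    rw [div_le_one (by positivity)]
    linarith [(Nat.cast_nonneg n : (0 : ℝ) ≤ n)]
  have hηlim : Tendsto η atTop (𝓝 0) := by
    simpa only [mul_zero] using (tendsto_one_div_add_atTop_nhds_zero_nat (𝕜 := ℝ)).const_mul ε
  choose a b ha hb hbδ hab hd using fun n => hA (η n ^ 3) (pow_pos (hη n) 3) δ hδ
  choose τ hτB hτ1 hτ2 using fun n =>
    H (η n) (hη n) (hηε n) (a n) (b n) (ha n) (hb n) (hbδ n) (hab n) (hd n)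
  have hτ0 : ∀ n, 0 < τ n := fun n =>
    (mul_pos (pow_pos (hη n) 2) (hb n)).trans (hτ1 n)
  have hτlim : Tendsto τ atTop (𝓝 0) := by
    refine squeeze_zero (fun n => (hτ0 n).le) (fun n => (hτ2 n).le.trans
      (mul_le_mul_of_nonneg_left (hbδ n).le (hη n).le)) ?_
    simpa using hηlim.mul_const δ
  obtain ⟨φ, hφ, hmono⟩ := strictMono_subseq_of_tendsto_atTop
    (tendsto_nhdsWithin_iff.2 ⟨hτlim, Eventually.of_forall hτ0⟩).inv_tendsto_nhdsGT_zero
  refine ⟨τ ∘ φ, ⟨⟨fun n => hτ0 _, fun m n hmn => ?_, hτlim.comp hφ.tendsto_atTop⟩,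
    fun n => ⟨hτB _, (hτ0 _).ne'⟩⟩, η ∘ φ, a ∘ φ, b ∘ φ, hηlim.comp hφ.tendsto_atTop, fun n =>
    ⟨hη _, ha _, ?_, (hτ2 _).le, hbδ _, hd _⟩⟩
  · have := hmono.monotone hmn
    exact (inv_le_inv₀ (hτ0 _) (hτ0 _)).1 this
  · calc a (φ n) ≤ η (φ n) ^ 3 * b (φ n) := hab _
      _ = η (φ n) * (η (φ n) ^ 2 * b (φ n)) := by ring
      _ ≤ η (φ n) * τ (φ n) := mul_le_mul_of_nonneg_left (hτ1 _).le (hη _).le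

lemma absorbable_of_mem_CSP {B : Set ℝ} (hB : B ∈ CSP) : B ∈ Absorbable := by
  intro A hA
  rw [mem_SP_iff] at hA ⊢
  refine ⟨union_subset hA.1 hB.1, ?_⟩
  -- It suffices to find gaps for `ε ≤ 1`.
  suffices h : ∀ ε : ℝ, 0 < ε → ε ≤ 1 → ∀ δ : ℝ, 0 < δ →
      ∃ a b : ℝ, 0 ≤ a ∧ 0 < b ∧ b < δ ∧ a ≤ ε * b ∧ Disjoint (Ioo a b) (A ∪ B) by
    intro ε hε δ hδ
    obtain ⟨a, b, ha, hb, hbδ, hab, hd⟩ := h (min ε 1) (lt_min hε one_pos) (min_le_right _ _) δ hδ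
    exact ⟨a, b, ha, hb, hbδ,
      hab.trans (mul_le_mul_of_nonneg_right (min_le_left _ _) hb.le), hd⟩
  intro ε hε hε1 δ hδ
  by_contra hno
  have H : ∀ η : ℝ, 0 < η → η ≤ ε → ∀ a b : ℝ, 0 ≤ a → 0 < b → b < δ → a ≤ η ^ 3 * b →
      Disjoint (Ioo a b) A → ∃ τ ∈ B, η ^ 2 * b < τ ∧ τ < η * b := by
    intro η hη hηε a b ha hb hbδ hab hd
    by_contra! hτ
    have hη1 : η ≤ 1 := hηε.trans hε1
    have hηb : η * b ≤ b := mul_le_of_le_one_left hb.le hη1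
    have hab' : a ≤ η ^ 2 * b := hab.trans
      (mul_le_mul_of_nonneg_right (pow_le_pow_of_le_one hη.le hη1 (by norm_num)) hb.le)
    refine hno ⟨η ^ 2 * b, η * b, by positivity, by positivity, hηb.trans_lt hbδ, ?_, ?_⟩
    · rw [pow_two, mul_assoc]
      exact mul_le_mul_of_nonneg_right hηε (by positivity)
    · rw [disjoint_union_right]
      refine ⟨hd.mono_left (Ioo_subset_Ioo hab' hηb), disjoint_left.2 fun x hx hxB => ?_⟩
      exact (hτ x hxB hx.1).not_gt hx.2
  obtain ⟨τ, hτ, η, a, b, hη, hab⟩ := exists_pointSeq_between hA.2 hε hδ H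
  obtain ⟨h, ⟨⟨hh0, -, -⟩, hgap⟩, c₁, c₂, hc₁, hc₂, hc⟩ := hB.2 τ hτ
  have e1 : ∀ᶠ n in atTop, 1 - ε / 2 < gap B (h n) / h n :=
    hgap.eventually (lt_mem_nhds (by linarith))
  have e2 : ∀ᶠ n in atTop, η n < ε * c₁ / 2 := hη.eventually (gt_mem_nhds (by positivity))
  have e3 : ∀ᶠ n in atTop, η n < 1 / c₂ := hη.eventually (gt_mem_nhds (by positivity))
  obtain ⟨n, h1, h2, h3⟩ := (e1.and (e2.and e3)).exists
  obtain ⟨hη0, ha0, haτ, hτb, hbδ, hd⟩ := hab n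
  obtain ⟨p, q, hp, hq, hqh, hpq, hdB⟩ := exists_gap_of_lt_gap_div hε hε1 (hh0 n) h1
  have hτ0 : 0 < τ n := hτ.1.1 n
  have hb0 : 0 < b n := pos_of_mul_pos_right (hτ0.trans_le hτb) hη0.le
  have haq : a n ≤ ε * q := by
    have t1 : η n * τ n ≤ ε * c₁ / 2 * τ n := mul_le_mul_of_nonneg_right h2.le hτ0.le
    have t2 : ε * (h n / 2) ≤ ε * q := mul_le_mul_of_nonneg_left hq.le hε.le
    have t3 : ε * (c₁ * τ n) ≤ ε * h n := mul_le_mul_of_nonneg_left (hc n).1 hε.le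
    linarith
  have hqb : q ≤ b n := by
    calc q ≤ c₂ * τ n := hqh.trans (hc n).2
      _ ≤ c₂ * (η n * b n) := mul_le_mul_of_nonneg_left hτb hc₂.le
      _ ≤ c₂ * (1 / c₂ * b n) := mul_le_mul_of_nonneg_left
          (mul_le_mul_of_nonneg_right h3.le hb0.le) hc₂.le
      _ = b n := by field_simp
  refine hno ⟨max (a n) p, q, le_max_of_le_left ha0, ?_, hqb.trans_lt hbδ, max_le haq hpq, ?_⟩
  · linarith [hh0 n]
  · rw [disjoint_union_right]
    exact ⟨hd.mono_left (Ioo_subset_Ioo (le_max_left _ _) hqb),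
      hdB.mono_left (Ioo_subset_Ioo (le_max_right _ _) le_rfl)⟩

/-! ### Geometric blocks -/

/-- The numbers `α ^ (0 + 1 + ⋯ + k) * α ^ (j ^ 3)` form a block family. -/
lemma exists_isBlockFamily {α : ℝ} (h0 : 0 < α) (h1 : α < 1) :
    ∃ y : ℕ → ℕ → ℝ, IsBlockFamily α y := by
  have hexp : ∀ j : ℕ, (∑ i ∈ Finset.range (j + 1), i) + j ^ 3 + j < (j + 1) ^ 3 := by
    intro j
    have := Finset.sum_range_id_mul_two (j + 1)
    simp only [Nat.add_sub_cancel] at this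
    nlinarith
  have hle : ∀ j : ℕ, α ^ (∑ i ∈ Finset.range (j + 1), i) * α ^ (j ^ 3) * α ^ j >
      α ^ ((j + 1) ^ 3) := by
    intro j
    rw [← pow_add, ← pow_add]
    exact pow_lt_pow_right_of_lt_one₀ h0 h1 (hexp j)
  refine ⟨fun k j => α ^ (∑ i ∈ Finset.range (k + 1), i) * α ^ (j ^ 3),
    fun j _ k _ => by positivity, ?_, ?_, ?_⟩
  · intro j _ k hk _
    obtain ⟨k, rfl⟩ := Nat.exists_eq_add_of_le' hk
    simp only [Nat.add_sub_cancel, Finset.sum_range_succ _ (k + 1), pow_add]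
    ring
  · intro j _
    simp only [zero_add, Finset.sum_range_one, pow_zero, one_mul]
    refine (hle j).trans_le (mul_le_of_le_one_right (by positivity) (pow_le_one₀ h0.le h1.le))
  · refine tendsto_atTop_mono (fun j => ?_)
      (tendsto_pow_atTop_atTop_of_one_lt ((one_lt_inv₀ h0).2 h1))
    simp only [zero_add, Finset.sum_range_one, pow_zero, one_mul]
    rw [inv_pow, le_div_iff₀ (by positivity), inv_mul_le_iff₀ (by positivity), mul_comm]
    exact (hle j).le

namespace IsBlockFamily

variable {α : ℝ} {y : ℕ → ℕ → ℝ}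

/-- Within a block the quotients of two entries do not depend on the block. -/
lemma eq_mul (hy : IsBlockFamily α y) {j m : ℕ} (hj : 1 ≤ j) : ∀ d, m + d ≤ j →
    y (m + d) j = α ^ (∑ i ∈ Finset.range d, (m + i + 1)) * y m j
  | 0, _ => by simp
  | d + 1, hd => by
    rw [Finset.sum_range_succ, pow_add, ← add_assoc,
      hy.step j hj (m + d + 1) (by omega) (by omega), Nat.add_sub_cancel,
      eq_mul hy hj d (by omega)]
    ring

lemma le_pow_mul (hy : IsBlockFamily α y) (h0 : 0 < α) (h1 : α < 1) {j m d : ℕ} (hj : 1 ≤ j)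
    (hd : m + d ≤ j) : y (m + d) j ≤ α ^ (d * (m + 1)) * y m j := by
  rw [hy.eq_mul hj d hd]
  refine mul_le_mul_of_nonneg_right (pow_le_pow_of_le_one h0.le h1.le ?_)
    (hy.pos j hj m (by omega)).le
  calc d * (m + 1) = ∑ i ∈ Finset.range d, (m + 1) := by simp
    _ ≤ _ := Finset.sum_le_sum fun i _ => by omega

lemma le_of_le (hy : IsBlockFamily α y) (h0 : 0 < α) (h1 : α < 1) {j k k' : ℕ} (hj : 1 ≤ j)
    (hk : k ≤ k') (hk' : k' ≤ j) : y k' j ≤ y k j := by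
  obtain ⟨d, rfl⟩ := Nat.exists_eq_add_of_le hk
  exact (hy.le_pow_mul h0 h1 hj hk').trans
    (mul_le_of_le_one_left (hy.pos j hj k (by omega)).le (pow_le_one₀ h0.le h1.le))

lemma zero_le_last_of_lt (hy : IsBlockFamily α y) (h0 : 0 < α) (h1 : α < 1) {j : ℕ} (hj : 1 ≤ j) :
    ∀ d, y 0 (j + d + 1) ≤ y j j
  | 0 => (hy.lt j hj).le
  | d + 1 => (hy.lt (j + d + 1) (by omega)).le.trans
      ((hy.le_of_le h0 h1 (by omega) (Nat.zero_le _) le_rfl).trans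
        (zero_le_last_of_lt hy h0 h1 hj d))

/-- The largest entry of block `j + 1` bounds all entries of the blocks after block `j`. -/
lemma le_zero_succ (hy : IsBlockFamily α y) (h0 : 0 < α) (h1 : α < 1) {j j' k' : ℕ} (hj : 1 ≤ j)
    (hjj : j < j') (hk' : k' ≤ j') : y k' j' ≤ y 0 (j + 1) := by
  refine (hy.le_of_le h0 h1 (by omega) (Nat.zero_le _) hk').trans ?_
  obtain ⟨d, rfl⟩ := Nat.exists_eq_add_of_le (Nat.succ_le_of_lt hjj)
  cases d with
  | zero => exact le_rfl
  | succ d =>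
    exact (hy.zero_le_last_of_lt h0 h1 (j := j + 1) (by omega) d).trans
      (hy.le_of_le h0 h1 (by omega) (Nat.zero_le _) le_rfl)

lemma le_of_block_lt (hy : IsBlockFamily α y) (h0 : 0 < α) (h1 : α < 1) {j j' k k' : ℕ}
    (hj : 1 ≤ j) (hjj : j < j') (hk : k ≤ j) (hk' : k' ≤ j') : y k' j' ≤ y k j :=
  (hy.le_zero_succ h0 h1 hj hjj hk').trans
    ((hy.lt j hj).le.trans (hy.le_of_le h0 h1 hj hk le_rfl))

lemma zero_le_pow (hy : IsBlockFamily α y) (h0 : 0 < α) (h1 : α < 1) :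
    ∀ j, y 0 (j + 1) ≤ α ^ j * y 0 1
  | 0 => by simp
  | j + 1 => by
    have hlast : y (j + 1) (j + 1) ≤ α ^ ((j + 1) * (0 + 1)) * y 0 (j + 1) := by
      simpa using hy.le_pow_mul h0 h1 (m := 0) (d := j + 1) (j := j + 1) (by omega) (by omega)
    have hα : α ^ ((j + 1) * (0 + 1)) ≤ α := by
      simpa using pow_le_pow_of_le_one h0.le h1.le (show 1 ≤ j + 1 by omega)
    have hpos := hy.pos (j + 1) (by omega) 0 (by omega)
    calc y 0 (j + 1 + 1) ≤ α * y 0 (j + 1) :=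
          (hy.lt (j + 1) (by omega)).le.trans
            (hlast.trans (mul_le_mul_of_nonneg_right hα hpos.le))
      _ ≤ α * (α ^ j * y 0 1) := mul_le_mul_of_nonneg_left (zero_le_pow hy h0 h1 j) h0.le
      _ = α ^ (j + 1) * y 0 1 := by ring

lemma tendsto_zero (hy : IsBlockFamily α y) (h0 : 0 < α) (h1 : α < 1) :
    Tendsto (fun j => y 0 j) atTop (𝓝 0) := by
  rw [← tendsto_add_atTop_iff_nat 1]
  refine squeeze_zero (fun j => (hy.pos (j + 1) (by omega) 0 (by omega)).le)
    (hy.zero_le_pow h0 h1) ?_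
  simpa using (tendsto_pow_atTop_nhds_zero_of_lt_one h0.le h1).mul_const (y 0 1)

lemma blockSet_subset (hy : IsBlockFamily α y) : blockSet y ⊆ Ici 0 := by
  rintro x ⟨j, k, hj, hk, rfl⟩
  exact (hy.pos j hj k hk).le

/-! ### Block sets are absorbable -/

/-- Two points of the block set close to `0` whose quotient exceeds `c` lie in the same block, and
the index of the larger one is bounded in terms of `c`. -/
lemma exists_bound_of_ratio (hy : IsBlockFamily α y) (h0 : 0 < α) (h1 : α < 1) {c : ℝ}
    (hc : 0 < c) : ∃ M : ℕ, ∃ δ : ℝ, 0 < δ ∧ ∀ j k j' k' : ℕ, 1 ≤ j → k ≤ j → 1 ≤ j' → k' ≤ j' →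
      y k j < δ → y k' j' < y k j → c * y k j < y k' j' → k < k' ∧ k < M := by
  obtain ⟨M, hM⟩ := exists_pow_lt_of_lt_one hc h1
  obtain ⟨J, hJ⟩ := eventually_atTop.1 (hy.sep.eventually_gt_atTop c⁻¹)
  refine ⟨M, y (J + 1) (J + 1), hy.pos _ (by omega) _ le_rfl, ?_⟩
  intro j k j' k' hj hk hj' hk' hδ hlt hcy
  have hpos := hy.pos j hj k hk
  have hJj : J + 1 < j := by
    by_contra! hle
    rcases hle.eq_or_lt with rfl | hlt'
    · exact (hy.le_of_le h0 h1 hj hk le_rfl).not_gt hδ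
    · exact (hy.le_of_block_lt h0 h1 hj hlt' hk le_rfl).not_gt hδ
  rcases lt_trichotomy j j' with hjj | rfl | hjj
  · exfalso
    have hz := hy.pos (j + 1) (by omega) 0 (by omega)
    have hs := hJ j (by omega)
    rw [lt_div_iff₀ hz, inv_mul_lt_iff₀ hc] at hs
    have hlast := mul_le_mul_of_nonneg_left (hy.le_of_le h0 h1 hj hk le_rfl) hc.le
    have := hy.le_zero_succ h0 h1 hj hjj hk'
    linarith
  · have hkk : k < k' := by
      by_contra! hle
      exact (hy.le_of_le h0 h1 hj hle hk).not_gt hlt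
    refine ⟨hkk, ?_⟩
    by_contra! hMk
    have hstep := hy.step j hj (k + 1) (by omega) (by omega)
    rw [Nat.add_sub_cancel] at hstep
    have hnext := hy.le_of_le h0 h1 hj (Nat.succ_le_of_lt hkk) hk'
    have hαM : α ^ (k + 1) ≤ α ^ M := pow_le_pow_of_le_one h0.le h1.le (by omega)
    have : α ^ (k + 1) * y k j ≤ c * y k j :=
      mul_le_mul_of_nonneg_right (hαM.trans hM.le) hpos.le
    simp only [Nat.succ_eq_add_one] at hnext
    linarith
  · exact absurd (hy.le_of_block_lt h0 h1 hj' hjj hk' hk) (not_le.2 hlt)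

lemma absorbable_blockSet (hy : IsBlockFamily α y) (h0 : 0 < α) (h1 : α < 1) :
    blockSet y ∈ Absorbable := by
  intro A hA
  rw [mem_SP_iff] at hA ⊢
  refine ⟨union_subset hA.1 hy.blockSet_subset, fun ε hε δ hδ => ?_⟩
  by_contra hno
  let q : ℝ := min ε (1 / 2)
  have hq0 : 0 < q := lt_min hε (by norm_num)
  have hq1 : q < 1 := (min_le_right _ _).trans_lt (by norm_num)
  obtain ⟨M, δ', hδ', hM⟩ := hy.exists_bound_of_ratio h0 h1 (pow_pos hq0 2)
  -- The gap of `A` is cut into the `M + 2` pieces `(q ^ (i + 1) * b, q ^ i * b)`.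
  obtain ⟨a, b, ha, hb, hbδ, hab, hd⟩ :=
    hA.2 (q ^ (M + 2)) (pow_pos hq0 _) (min δ δ') (lt_min hδ hδ')
  have hqb : ∀ i, q ^ i * b ≤ b := fun i =>
    mul_le_of_le_one_left hb.le (pow_le_one₀ hq0.le hq1.le)
  have hpt : ∀ i, i < M + 2 → ∃ j k : ℕ, 1 ≤ j ∧ k ≤ j ∧ q ^ (i + 1) * b < y k j ∧
      y k j < q ^ i * b := by
    intro i hi
    by_contra! hempty
    refine hno ⟨q ^ (i + 1) * b, q ^ i * b, by positivity, by positivity,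
      (hqb i).trans_lt (hbδ.trans_le (min_le_left _ _)), ?_, ?_⟩
    · rw [pow_succ', mul_assoc]
      exact mul_le_mul_of_nonneg_right (min_le_left _ _) (by positivity)
    · rw [disjoint_union_right]
      refine ⟨hd.mono_left (Ioo_subset_Ioo (hab.trans (mul_le_mul_of_nonneg_right
        (pow_le_pow_of_le_one hq0.le hq1.le (by omega)) hb.le)) (hqb i)), ?_⟩
      refine disjoint_left.2 ?_
      rintro x hx ⟨j, k, hj, hk, rfl⟩
      exact (hempty j k hj hk hx.1).not_gt hx.2
  choose! j k hj hk hl hu using hpt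
  have hstep : ∀ i, i + 1 < M + 2 → k i < k (i + 1) ∧ k i < M := by
    intro i hi
    refine hM (j i) (k i) (j (i + 1)) (k (i + 1)) (hj i (by omega)) (hk i (by omega))
      (hj _ hi) (hk _ hi) ?_ ((hu _ hi).trans (hl i (by omega))) ?_
    · exact (hu i (by omega)).trans_le ((hqb i).trans (hbδ.le.trans (min_le_right _ _)))
    · calc q ^ 2 * y (k i) (j i) < q ^ 2 * (q ^ i * b) :=
            mul_lt_mul_of_pos_left (hu i (by omega)) (pow_pos hq0 2)
        _ = q ^ (i + 1 + 1) * b := by ring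
        _ < _ := hl _ hi
  have hge : ∀ i, i < M + 2 → i ≤ k i := by
    intro i
    induction i with
    | zero => intro; exact Nat.zero_le _
    | succ i ih =>
      intro hi
      have := ih (by omega)
      have := (hstep i hi).1
      omega
  have := hge M (by omega)
  have := (hstep M (by omega)).2
  omega

/-! ### Block sets are not finite unions of completely strongly porous sets -/

/-- If a completely strongly porous set contains the `m`-th entry of almost all blocks, then for
all large `m'` it misses the `m'`-th entry of almost all blocks. -/
lemma eventually_notMem_of_mem_CSP (hy : IsBlockFamily α y) (h0 : 0 < α) (h1 : α < 1)
    {A : Set ℝ} (hA : A ∈ CSP) {U : Filter ℕ} [U.NeBot] (hU : U ≤ atTop) {m : ℕ}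
    (hm : ∀ᶠ j in U, y m j ∈ A) : ∀ᶠ m' in atTop, ∀ᶠ j in U, y m' j ∉ A := by
  let S : Set ℕ := {j | y m j ∈ A ∧ m + 1 ≤ j}
  have hS : S ∈ U := hm.and (hU (eventually_ge_atTop (m + 1)))
  have hSinf : S.Infinite :=
    Nat.frequently_atTop_iff_infinite.1 ((Eventually.frequently hS).filter_mono hU)
  have hmono : StrictMono (Nat.nth (· ∈ S)) := Nat.nth_strictMono hSinf
  have hmem : ∀ n, Nat.nth (· ∈ S) n ∈ S := Nat.nth_mem_of_infinite hSinf
  set φ := Nat.nth (· ∈ S)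
  have hτ : (fun n => y m (φ n)) ∈ pointSeqs A := by
    have hpos : ∀ n, 0 < y m (φ n) := fun n =>
      hy.pos _ (by have := (hmem n).2; omega) _ (by have := (hmem n).2; omega)
    refine ⟨⟨hpos, antitone_nat_of_succ_le fun n => ?_, ?_⟩, fun n => ⟨(hmem n).1, (hpos n).ne'⟩⟩
    · have h₁ := (hmem n).2
      have h₂ := (hmem (n + 1)).2
      exact hy.le_of_block_lt h0 h1 (by omega) (hmono n.lt_succ_self) (by omega) (by omega)
    · refine squeeze_zero (fun n => (hpos n).le) (fun n => ?_)
        ((hy.tendsto_zero h0 h1).comp hmono.tendsto_atTop)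
      have h₁ := (hmem n).2
      exact hy.le_of_le h0 h1 (by omega) (Nat.zero_le _) (by omega)
  obtain ⟨h, ⟨⟨hh0, -, -⟩, hgap⟩, c₁, c₂, hc₁, hc₂, hc⟩ := hA.2 _ hτ
  obtain ⟨M, hM⟩ := exists_pow_lt_of_lt_one (half_pos hc₁) h1
  filter_upwards [eventually_ge_atTop (m + M)] with m' hm'
  obtain ⟨d, rfl⟩ := Nat.exists_eq_add_of_le (show m ≤ m' by omega)
  -- The quotient `y (m + d) j / y m j` is the constant `β`.
  let β : ℝ := α ^ (∑ i ∈ Finset.range d, (m + i + 1))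
  have hβ0 : 0 < β := pow_pos h0 _
  have hβ : β < c₁ / 2 := by
    refine (pow_le_pow_of_le_one h0.le h1.le ?_).trans_lt hM
    calc M ≤ ∑ i ∈ Finset.range d, 1 := by simp; omega
      _ ≤ _ := Finset.sum_le_sum fun i _ => by omega
  have hε : 0 < min 1 (β / (2 * c₂)) := lt_min one_pos (by positivity)
  obtain ⟨N, hN⟩ := eventually_atTop.1
    (hgap.eventually (lt_mem_nhds (show 1 - min 1 (β / (2 * c₂)) / 2 < 1 by linarith)))
  filter_upwards [hS, hU (eventually_ge_atTop (φ N)), hU (eventually_ge_atTop (m + d))]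
    with j hjS hjN hjd
  obtain ⟨n, rfl⟩ : ∃ n, φ n = j := by
    have : j ∈ Set.range (Nat.nth (· ∈ S)) := by
      rw [Nat.range_nth_of_infinite (p := (· ∈ S)) hSinf]
      exact hjS
    exact this
  have hj1 := hjS.2
  obtain ⟨p, q, hp, hq, hqh, hpq, hd⟩ := exists_gap_of_lt_gap_div hε (min_le_left _ _) (hh0 n)
    (hN n (hmono.le_iff_le.1 hjN))
  have hτ0 : 0 < y m (φ n) := hτ.1.1 n
  have hq0 : 0 < q := by linarith [hh0 n]
  have heq : y (m + d) (φ n) = β * y m (φ n) := hy.eq_mul (by omega) d hjd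
  obtain ⟨hc1, hc2⟩ := hc n
  have hqτ : β * y m (φ n) < q := by
    have := mul_lt_mul_of_pos_right hβ hτ0
    linarith
  have hpτ : p < β * y m (φ n) := by
    calc p ≤ min 1 (β / (2 * c₂)) * q := hpq
      _ ≤ β / (2 * c₂) * (c₂ * y m (φ n)) :=
          mul_le_mul (min_le_right _ _) (hqh.trans hc2) hq0.le (by positivity)
      _ = β * y m (φ n) / 2 := by field_simp
      _ < β * y m (φ n) := half_lt_self (by positivity)
  have hgap_mem : y (m + d) (φ n) ∈ Ioo p q := by
    rw [heq]
    exact ⟨hpτ, hqτ⟩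
  exact Set.disjoint_left.1 hd hgap_mem

lemma blockSet_notMem_generatedIdeal (hy : IsBlockFamily α y) (h0 : 0 < α) (h1 : α < 1) :
    blockSet y ∉ generatedIdeal CSP := by
  rintro ⟨n, -, A, hA, hE⟩
  let U : Ultrafilter ℕ := hyperfilter ℕ
  have hU : (U : Filter ℕ) ≤ atTop := Nat.hyperfilter_le_atTop
  have key : ∀ i, ∀ᶠ m in atTop, ¬ ∀ᶠ j in (U : Filter ℕ), y m j ∈ A i := by
    intro i
    by_cases hm : ∃ m, ∀ᶠ j in (U : Filter ℕ), y m j ∈ A i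
    · obtain ⟨m, hm⟩ := hm
      filter_upwards [hy.eventually_notMem_of_mem_CSP h0 h1 (hA i) hU hm] with m' hm' hmem
      obtain ⟨j, hj, hj'⟩ := (hm'.and hmem).exists
      exact hj hj'
    · exact Eventually.of_forall fun m h => hm ⟨m, h⟩
  obtain ⟨m, hm⟩ := (eventually_all.2 key).exists
  have hcover : ∀ᶠ j in (U : Filter ℕ), ∃ i, y m j ∈ A i := by
    filter_upwards [hU (eventually_ge_atTop (m + 1))] with j hj
    have : y m j ∈ blockSet y := ⟨j, m, by omega, by omega, rfl⟩
    rw [hE] at this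
    exact mem_iUnion.1 this
  obtain ⟨i, hi⟩ := Ultrafilter.eventually_exists_iff.1 hcover
  exact hm i hi

end IsBlockFamily

end RightPorosity

open RightPorosity in
theorem corollary7p6 :
    RightPorosity.generatedIdeal RightPorosity.CSP ⊂
        RightPorosity.hatIdeal RightPorosity.SP ∧
      ∀ α : ℝ, 0 < α → α < 1 →
        (∃ y : ℕ → ℕ → ℝ, RightPorosity.IsBlockFamily α y) ∧
          ∀ y : ℕ → ℕ → ℝ, RightPorosity.IsBlockFamily α y →
            RightPorosity.blockSet y ∈ RightPorosity.hatIdeal RightPorosity.SP ∧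
              RightPorosity.blockSet y ∉
                RightPorosity.generatedIdeal RightPorosity.CSP := by
  have hblock : ∀ (α : ℝ), 0 < α → α < 1 → ∀ y : ℕ → ℕ → ℝ, IsBlockFamily α y →
      blockSet y ∈ hatIdeal SP ∧ blockSet y ∉ generatedIdeal CSP := fun α h0 h1 y hy =>
    ⟨absorbable_subset_hatIdeal (hy.absorbable_blockSet h0 h1),
      hy.blockSet_notMem_generatedIdeal h0 h1⟩
  refine ⟨⟨?_, fun hsub => ?_⟩, fun α h0 h1 => ⟨exists_isBlockFamily h0 h1, hblock α h0 h1⟩⟩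
  · rintro B ⟨n, -, A, hA, rfl⟩
    exact absorbable_subset_hatIdeal (iUnion_mem_absorbable fun j => absorbable_of_mem_CSP (hA j))
  · obtain ⟨y, hy⟩ := exists_isBlockFamily (α := 1 / 2) (by norm_num) (by norm_num)
    obtain ⟨hmem, hnot⟩ := hblock (1 / 2) (by norm_num) (by norm_num) y hy
    exact hnot (hsub hmem)
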